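/- Let $1<p<\infty$, let $\Delta_0=[a,b]$ with $a<b$ and $\Delta_1=[c,d]$ with $c\le d$ be bounded real intervals whose interiors are disjoint, and let $\mu_0,\mu_1$ be finite positive Borel measures on $\mathbb{R}$ whose supports are contained in $\Delta_0$ and $\Delta_1$ respectively, the support of $\mu_0$ being an infinite set. For a polynomial $f$ with complex coefficients put $$\|f\|_{S,p}=\left(\int |f|^p\,d\mu_0+\int |f'|^p\,d\mu_1\right)^{1/p},$$ and for $n\ge 0$ let $L_n$ be the $n$th monic extremal polynomial, i.e. the monic polynomial of degree $n$ with $\|L_n\|_{S,p}=\min\|Q\|_{S,p}$, the minimum being taken over all monic polynomials $Q$ of degree $n$ with complex coefficients. Write $D(\zeta,r)=\{z\in\mathbb{C}:|z-\zeta|<r\}$. If $b\le c$, then all zeros of $L_n$ lie in $D(d,d-a)\cup D(a,b-a)$. If $d\le a$, then all zeros of $L_n$ lie in $D(c,b-c)\cup D(b,b-a)$. -/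

import Mathlib

open MeasureTheory

/-- The Sobolev `p`-norm
`(∫ |f|^p dμ₀ + ∫ |f'|^p dμ₁)^(1/p)` of a polynomial `f` with complex coefficients,
for measures `μ₀`, `μ₁` on the real line. -/
noncomputable def sobolevNorm (p : ℝ) (μ₀ μ₁ : Measure ℝ) (f : Polynomial ℂ) : ℝ :=
  ((∫ x : ℝ, ‖f.eval (x : ℂ)‖ ^ p ∂μ₀)
    + ∫ x : ℝ, ‖f.derivative.eval (x : ℂ)‖ ^ p ∂μ₁) ^ (1 / p)

/-- `L` is an `n`th monic extremal polynomial relative to the Sobolev `p`-norm: it is monic of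
exact degree `n`, and its norm is minimal among all monic polynomials of degree `n` with complex
coefficients. -/
def IsMonicExtremal (p : ℝ) (μ₀ μ₁ : Measure ℝ) (n : ℕ) (L : Polynomial ℂ) : Prop :=
  L.Monic ∧ L.natDegree = n ∧
    ∀ Q : Polynomial ℂ, Q.Monic → Q.natDegree = n →
      sobolevNorm p μ₀ μ₁ L ≤ sobolevNorm p μ₀ μ₁ Q

/-! Take `b ≤ c`; the reflection `x ↦ -x` gives the other case. Replacing the extremal polynomial by
its real part on the line does not increase the norm, so it is real
(`IsMonicExtremal.exists_eq_map`); call it `f`. The vanishing first variation forbids a nonzero `q`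
of lower degree with `f q ≥ 0` on `[a, b]` and `f' q' ≥ 0` on `[c, d]`
(`IsMonicExtremal.isSignExtremal`). Test polynomials with prescribed sign changes then force so many
sign changes of `f` on `(a, b)` and of `f'` on `(c, d)` that, with Rolle's theorem, all critical
points are real, simple and in `[x₁, d]` for some zero `x₁ > a` of `f`
(`IsSignExtremal.exists_derivative_roots`).

If `z` is another zero, then `f x₁ = f z`, and Grace's theorem gives a critical point `y` with `|y -
z| ≤ |y - x₁| = y - x₁` (`exists_derivative_root_norm_sub_le`). Hence `|z - d| ≤ (y - x₁) + (d - y)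
< d - a`. -/

/-! ### The theorems of Laguerre and Grace for half-planes -/

open Polynomial in
/-- The polynomial `v ↦ Φ ((X - v) ^ N)` attached to a linear functional `Φ`. -/
noncomputable def powFunctional (Φ : ℂ[X] →ₗ[ℂ] ℂ) (N : ℕ) : ℂ[X] :=
  ∑ j ∈ Finset.range (N + 1), C (Φ (X ^ j) * (N.choose j : ℂ) * (-1) ^ (N - j)) * X ^ (N - j)

open Polynomial in
theorem natDegree_powFunctional_le (Φ : ℂ[X] →ₗ[ℂ] ℂ) (N : ℕ) :
    (powFunctional Φ N).natDegree ≤ N :=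
  natDegree_sum_le_of_forall_le _ _ fun _ _ =>
    (natDegree_C_mul_X_pow_le _ _).trans (Nat.sub_le _ _)

open Polynomial in
theorem eval_powFunctional (Φ : ℂ[X] →ₗ[ℂ] ℂ) (N : ℕ) (v : ℂ) :
    (powFunctional Φ N).eval v = Φ ((X - C v) ^ N) := by
  rw [sub_eq_add_neg, add_pow, map_sum, powFunctional, eval_finsetSum]
  refine Finset.sum_congr rfl fun j _ => ?_
  have : (X : ℂ[X]) ^ j * (-C v) ^ (N - j) * (N.choose j : ℂ[X])
      = ((-v) ^ (N - j) * (N.choose j : ℂ)) • (X : ℂ[X]) ^ j := by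
    rw [smul_eq_C_mul, C_mul, C_pow, C_neg, C_eq_natCast]
    ring
  rw [this, map_smul, smul_eq_mul, neg_pow v]
  simp only [eval_mul, eval_C, eval_pow, eval_X]
  ring

-- Differentiation in `v` passes through `Φ`. This makes the polar derivative of `Φ ((X - v) ^ (m +
-- 1))` again a value of a functional on `m`th powers.
open Polynomial in
theorem derivative_powFunctional (Φ : ℂ[X] →ₗ[ℂ] ℂ) (m : ℕ) :
    derivative (powFunctional Φ (m + 1)) = C (-((m + 1 : ℕ) : ℂ)) * powFunctional Φ m := by
  rw [powFunctional, Finset.sum_range_succ, derivative_add, derivative_sum, powFunctional,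
    Finset.mul_sum]
  have hlast : derivative (C (Φ (X ^ (m + 1)) * ((m + 1).choose (m + 1) : ℂ)
      * (-1) ^ (m + 1 - (m + 1))) * X ^ (m + 1 - (m + 1))) = 0 := by simp
  rw [hlast, add_zero]
  refine Finset.sum_congr rfl fun j hj => ?_
  have hj : j ≤ m := Nat.lt_succ_iff.mp (Finset.mem_range.mp hj)
  have hchoose : ((m.choose j : ℕ) : ℂ) * ((m + 1 : ℕ) : ℂ)
      = ((m + 1).choose j : ℂ) * ((m - j + 1 : ℕ) : ℂ) := by
    rw [← Nat.sub_add_comm hj]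
    exact_mod_cast Nat.choose_mul_succ_eq m j
  rw [Nat.sub_add_comm hj, derivative_C_mul_X_pow, Nat.add_sub_cancel, ← mul_assoc, ← C_mul]
  congr 2
  linear_combination (Φ (X ^ j) * (-1) ^ (m - j)) * hchoose

theorem norm_sum_add_card_mul_le (r : ℝ) (S : Multiset ℂ) (hS : ∀ u ∈ S, ‖u + r‖ ≤ r) :
    ‖S.sum + S.card * r‖ ≤ S.card * r := by
  induction S using Multiset.induction with
  | empty => simp
  | cons u S ih =>
    have h1 := ih fun x hx => hS x (Multiset.mem_cons_of_mem hx)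
    have h2 := hS u (Multiset.mem_cons_self u S)
    have h3 := norm_add_le (u + r) (S.sum + S.card * r)
    have h4 : (u ::ₘ S).sum + ((u ::ₘ S).card : ℂ) * r = (u + r) + (S.sum + S.card * r) := by
      rw [Multiset.sum_cons, Multiset.card_cons]
      push_cast
      ring
    rw [h4, Multiset.card_cons]
    push_cast
    linarith

/-- Inversion maps the half-plane `re x ≤ -δ` into a disc through the origin. -/
theorem norm_inv_add_le_iff {δ : ℝ} (hδ : 0 < δ) {x : ℂ} (hx : x ≠ 0) :
    ‖x⁻¹ + (((2 * δ)⁻¹ : ℝ) : ℂ)‖ ≤ (2 * δ)⁻¹ ↔ x.re ≤ -δ := by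
  have hr : 0 < (2 * δ)⁻¹ := by positivity
  have hx' : 0 < ‖x‖ := norm_pos_iff.mpr hx
  set r := (2 * δ)⁻¹ with hrdef
  have h2 : 2 * δ * r = 1 := mul_inv_cancel₀ (by positivity)
  have h1 : x⁻¹ + (r : ℂ) = (1 + r * x) * x⁻¹ := by field_simp
  rw [h1, norm_mul, norm_inv, ← div_eq_mul_inv, div_le_iff₀ hx',
    ← abs_of_nonneg (norm_nonneg (1 + r * x)), ← abs_of_nonneg (by positivity : 0 ≤ r * ‖x‖),
    ← sq_le_sq, mul_pow, ← Complex.normSq_eq_norm_sq, ← Complex.normSq_eq_norm_sq,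
    Complex.normSq_apply, Complex.normSq_apply]
  simp only [Complex.add_re, Complex.one_re, Complex.mul_re, Complex.ofReal_re, Complex.ofReal_im,
    Complex.add_im, Complex.one_im, Complex.mul_im, zero_mul, sub_zero, add_zero, zero_add]
  -- As `2 * δ * r = 1`, the difference of the two squared norms is `2r(δ + re x)`, whose sign
  -- decides.
  have h3 : (1 + r * x.re) * (1 + r * x.re) + r * x.im * (r * x.im)
      = 2 * r * (δ + x.re) + r ^ 2 * (x.re * x.re + x.im * x.im) := by
    linear_combination (-1 : ℝ) * h2
  rw [h3]
  constructor
  · intro h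
    by_contra hcon
    have : 0 < 2 * r * (δ + x.re) := by
      have : 0 < δ + x.re := by linarith
      positivity
    linarith
  · intro h
    have : 2 * r * (δ + x.re) ≤ 0 := mul_nonpos_of_nonneg_of_nonpos (by positivity) (by linarith)
    linarith

open Polynomial in
/-- **Laguerre's theorem** for a half-plane free of zeros. -/
theorem polar_derivative_ne_zero {κ : ℂ} (hκ : κ ≠ 0) (h : ℝ) {N : ℕ} {P : ℂ[X]}
    (hdeg : P.natDegree ≤ N) (hP : ∀ v, (κ * v).re < h → P.eval v ≠ 0) {v w : ℂ}
    (hv : (κ * v).re < h) (hw : (κ * w).re < h) (hN : 0 < N) :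
    N * P.eval v ≠ (v - w) * P.derivative.eval v := by
  intro heq
  have hPv := hP v hv
  have hN' : (N : ℂ) ≠ 0 := by exact_mod_cast hN.ne'
  have hvw : v - w ≠ 0 := by
    intro h0
    rw [h0, zero_mul] at heq
    exact mul_ne_zero hN' hPv heq
  have hsum := (IsAlgClosed.splits P).eval_derivative_div_eval_of_ne_zero hPv
  set δ : ℝ := h - (κ * v).re with hδdef
  have hδ : 0 < δ := sub_pos.mpr hv
  set r : ℝ := (2 * δ)⁻¹ with hrdef
  have hr : 0 < r := by positivity
  set S : Multiset ℂ := P.roots.map fun z => (κ * (v - z))⁻¹ with hS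
  have hSle : ∀ u ∈ S, ‖u + r‖ ≤ r := by
    intro u hu
    obtain ⟨z, hz, rfl⟩ := Multiset.mem_map.mp hu
    have hroot : P.eval z = 0 := (mem_roots'.mp hz).2
    have hz1 : h ≤ (κ * z).re := by
      by_contra hlt
      exact hP z (not_le.mp hlt) hroot
    have hvz : v - z ≠ 0 := by
      intro h0
      rw [sub_eq_zero] at h0
      exact hPv (h0 ▸ hroot)
    refine (norm_inv_add_le_iff hδ (mul_ne_zero hκ hvz)).mpr ?_
    rw [mul_sub, Complex.sub_re]
    linarith
  have hSsum : S.sum = N * (κ * (v - w))⁻¹ := by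
    have h1 : S.sum = κ⁻¹ * (P.derivative.eval v / P.eval v) := by
      rw [hsum, hS, ← Multiset.sum_map_mul_left]
      simp only [mul_inv, one_div]
    rw [h1]
    field_simp
    linear_combination -heq
  have hcard : (S.card : ℝ) ≤ N := by
    rw [hS, Multiset.card_map]
    exact_mod_cast (card_roots' P).trans hdeg
  have h1 := norm_sum_add_card_mul_le r S hSle
  -- The `N - S.card` missing zeros count as zeros at infinity: their reciprocals are `0`, a
  -- boundary point of the disc. So the mean of `N` points of the disc is `(κ (v - w))⁻¹`, and
  -- inverting back puts `w` outside the half-plane.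
  have h2 : (N : ℂ) * ((κ * (v - w))⁻¹ + r) = (S.sum + S.card * r) + ((N - S.card : ℝ) * r : ℝ) := by
    rw [hSsum]
    push_cast
    ring
  have h3 : (N : ℝ) * ‖(κ * (v - w))⁻¹ + r‖ ≤ N * r := by
    calc (N : ℝ) * ‖(κ * (v - w))⁻¹ + r‖ = ‖(N : ℂ) * ((κ * (v - w))⁻¹ + r)‖ := by simp
      _ ≤ ‖S.sum + S.card * r‖ + ‖(((N - S.card : ℝ) * r : ℝ) : ℂ)‖ := by
          rw [h2]; exact norm_add_le _ _
      _ ≤ S.card * r + (N - S.card : ℝ) * r := by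
          refine add_le_add h1 (le_of_eq ?_)
          rw [Complex.norm_real, Real.norm_of_nonneg]
          exact mul_nonneg (sub_nonneg.mpr hcard) hr.le
      _ = N * r := by ring
  have h4 := le_of_mul_le_mul_left h3 (by exact_mod_cast hN)
  have h5 := (norm_inv_add_le_iff hδ (mul_ne_zero hκ hvw)).mp h4
  rw [mul_sub, Complex.sub_re] at h5
  linarith

open Polynomial in
/-- **Grace's theorem** for a half-plane: a linear functional which vanishes at no power
`(X - v) ^ m` with `v` in the half-plane vanishes at no product of `m` factors `X - y` with `y` in
the half-plane. -/
theorem functional_prod_X_sub_C_ne_zero {κ : ℂ} (hκ : κ ≠ 0) (h : ℝ) (S : Multiset ℂ)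
    (hS : ∀ y ∈ S, (κ * y).re < h) (Φ : ℂ[X] →ₗ[ℂ] ℂ)
    (hΦ : ∀ v, (κ * v).re < h → Φ ((X - C v) ^ S.card) ≠ 0)
    (hne : ∃ v : ℂ, (κ * v).re < h) :
    Φ (S.map fun y => X - C y).prod ≠ 0 := by
  induction S using Multiset.induction generalizing Φ with
  | empty =>
    obtain ⟨v, hv⟩ := hne
    simpa using hΦ v hv
  | cons w S ih =>
    rw [Multiset.map_cons, Multiset.prod_cons]
    refine ih (fun y hy => hS y (Multiset.mem_cons_of_mem hy))
      (Φ ∘ₗ LinearMap.mulLeft ℂ (X - C w)) fun v hv h0 => ?_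
    have hw := hS w (Multiset.mem_cons_self w S)
    rw [Multiset.card_cons] at hΦ
    -- With `P v = Φ ((X - v) ^ (m + 1))`, the new functional at `(X - v) ^ m` is `P v - (v - w) P'
    -- v / (m + 1)`, which Laguerre's theorem keeps from vanishing.
    refine polar_derivative_ne_zero hκ h (natDegree_powFunctional_le Φ (S.card + 1))
      (fun z hz => by rw [eval_powFunctional]; exact hΦ z hz) hv hw (Nat.succ_pos _) ?_
    have h1 : (X - C w) * (X - C v) ^ S.card
        = (X - C v) ^ (S.card + 1) + (v - w) • (X - C v) ^ S.card := by
      rw [smul_eq_C_mul, C_sub]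
      ring
    rw [LinearMap.comp_apply, LinearMap.mulLeft_apply, h1, map_add, map_smul, smul_eq_mul] at h0
    rw [derivative_powFunctional, eval_mul, eval_C, eval_powFunctional, eval_powFunctional]
    linear_combination ((S.card + 1 : ℕ) : ℂ) * h0

/-! ### Critical points of a polynomial with two equal values -/

open Polynomial in
/-- The linear functional `f ↦ ∫ f` over a path from `α` to `β`. -/
noncomputable def pathIntegral (α β : ℂ) : ℂ[X] →ₗ[ℂ] ℂ :=
  Polynomial.lsum fun j =>
    LinearMap.toSpanSingleton ℂ ℂ ((β ^ (j + 1) - α ^ (j + 1)) / ((j : ℂ) + 1))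

open Polynomial in
theorem pathIntegral_derivative (α β : ℂ) (f : ℂ[X]) :
    pathIntegral α β (derivative f) = f.eval β - f.eval α := by
  induction f using Polynomial.induction_on' with
  | add f g hf hg => rw [derivative_add, map_add, hf, hg, eval_add, eval_add]; ring
  | monomial n a =>
    rw [derivative_monomial, eval_monomial, eval_monomial]
    cases n with
    | zero => simp
    | succ n =>
      have : (n : ℂ) + 1 ≠ 0 := by exact_mod_cast Nat.succ_ne_zero n
      simp [pathIntegral, Polynomial.lsum, sum_monomial_index]
      field_simp

open Polynomial in
/-- If a polynomial takes the same value at `α` and `β`, then its critical points do not all lie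
strictly closer to `α` than to `β`. -/
theorem exists_derivative_root_norm_sub_le {f : ℂ[X]} {α β : ℂ} (hαβ : α ≠ β)
    (heq : f.eval α = f.eval β) (hf : derivative f ≠ 0) :
    ∃ y, (derivative f).IsRoot y ∧ ‖y - β‖ ≤ ‖y - α‖ := by
  by_contra! hcon
  -- Expanding the squared distances writes the side of the bisector nearer `α` as a half-plane `re
  -- (κ v) < h`.
  have key : ∀ v : ℂ, ((2 * (starRingEnd ℂ) (β - α)) * v).re < Complex.normSq β - Complex.normSq α
      ↔ ‖v - α‖ < ‖v - β‖ := by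
    intro v
    rw [← sq_lt_sq₀ (norm_nonneg _) (norm_nonneg _), ← Complex.normSq_eq_norm_sq,
      ← Complex.normSq_eq_norm_sq]
    simp only [Complex.normSq_apply, Complex.mul_re, Complex.mul_im, Complex.sub_re,
      Complex.sub_im, Complex.conj_re, Complex.conj_im, Complex.re_ofNat, Complex.im_ofNat]
    constructor <;> intro h <;> nlinarith
  have hsplit := (IsAlgClosed.splits (derivative f)).natDegree_eq_card_roots
  have hprod := C_leadingCoeff_mul_prod_multiset_X_sub_C hsplit.symm
  have hκ : 2 * (starRingEnd ℂ) (β - α) ≠ 0 :=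
    mul_ne_zero two_ne_zero ((_root_.map_ne_zero _).mpr (sub_ne_zero.mpr hαβ.symm))
  refine functional_prod_X_sub_C_ne_zero hκ
    (Complex.normSq β - Complex.normSq α) (derivative f).roots
    (fun y hy => (key y).mpr (hcon y (mem_roots'.mp hy).2)) (pathIntegral α β) ?_
    ⟨α, (key α).mpr ?_⟩ ?_
  -- The integral of `(X - v) ^ m` vanishes only if `(β - v) ^ (m + 1) = (α - v) ^ (m + 1)`, which
  -- makes `v` equidistant from `α` and `β`.
  · intro v hv h0
    set m := (derivative f).roots.card
    have h1 : derivative ((X - C v) ^ (m + 1)) = ((m + 1 : ℕ) : ℂ) • (X - C v) ^ m := by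
      rw [derivative_X_sub_C_pow, smul_eq_C_mul, Nat.add_sub_cancel, C_eq_natCast]
    have h2 := pathIntegral_derivative α β ((X - C v) ^ (m + 1))
    rw [h1, map_smul, h0, smul_zero] at h2
    simp only [eval_pow, eval_sub, eval_X, eval_C] at h2
    have h3 : ‖β - v‖ ^ (m + 1) = ‖α - v‖ ^ (m + 1) := by
      rw [← norm_pow, ← norm_pow, sub_eq_zero.mp h2.symm]
    have h4 := (pow_left_inj₀ (norm_nonneg _) (norm_nonneg _) (Nat.succ_ne_zero m)).mp h3
    have h5 := (key v).mp hv
    rw [norm_sub_rev v α, norm_sub_rev v β, h4] at h5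
    exact lt_irrefl _ h5
  · rw [sub_self, norm_zero]
    exact norm_pos_iff.mpr (sub_ne_zero.mpr hαβ)
  · have h1 := pathIntegral_derivative α β f
    rw [heq, sub_self, ← hprod, ← smul_eq_C_mul, map_smul, smul_eq_mul] at h1
    exact (mul_eq_zero.mp h1).resolve_left (leadingCoeff_ne_zero.mpr hf)

/-! ### Sign changes and comparison polynomials -/

open Polynomial in
/-- A nonzero real polynomial has constant sign on `[u, v]` once it is multiplied by linear factors
at suitable zeros of it in `(u, v)`. -/
theorem exists_sign_changes (u v : ℝ) (f : ℝ[X]) (hf : f ≠ 0) :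
    ∃ (S : Finset ℝ) (σ : ℝ), (σ = 1 ∨ σ = -1) ∧ (∀ x ∈ S, x ∈ Set.Ioo u v ∧ f.eval x = 0) ∧
      ∀ x ∈ Set.Icc u v, 0 ≤ σ * f.eval x * ∏ y ∈ S, (x - y) := by
  induction hn : f.natDegree generalizing f with
  | zero =>
    rw [eq_C_of_natDegree_eq_zero hn]
    rcases le_total 0 (f.coeff 0) with h | h
    · exact ⟨∅, 1, Or.inl rfl, by simp, by simpa using fun _ _ _ => h⟩
    · exact ⟨∅, -1, Or.inr rfl, by simp, by simpa using fun _ _ _ => h⟩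
  | succ n ih =>
    by_cases hroot : ∃ r ∈ Set.Ioo u v, f.eval r = 0
    · obtain ⟨r, hr, hr0⟩ := hroot
      obtain ⟨g, rfl⟩ := dvd_iff_isRoot.mpr hr0
      have hg : g ≠ 0 := right_ne_zero_of_mul hf
      have hdeg : g.natDegree = n := by
        rw [natDegree_mul (X_sub_C_ne_zero r) hg, natDegree_X_sub_C] at hn
        omega
      obtain ⟨S, σ, hσ, hS, hsign⟩ := ih g hg hdeg
      -- The factor `X - r` flips the parity of the order of `r`, so membership of `r` is toggled:
      -- `S` collects the zeros of odd order.
      by_cases hrS : r ∈ S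
      · refine ⟨S.erase r, σ, hσ, fun x hx => ?_, fun x hx => ?_⟩
        · obtain ⟨h1, h2⟩ := hS x (Finset.mem_of_mem_erase hx)
          exact ⟨h1, by simp [h2]⟩
        · have h1 := hsign x hx
          rw [← Finset.mul_prod_erase S _ hrS] at h1
          refine h1.trans_eq ?_
          simp only [eval_mul, eval_sub, eval_X, eval_C]
          ring
      · refine ⟨insert r S, σ, hσ, fun x hx => ?_, fun x hx => ?_⟩
        · rcases Finset.mem_insert.mp hx with rfl | hx
          · exact ⟨hr, hr0⟩
          · exact ⟨(hS x hx).1, by simp [(hS x hx).2]⟩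
        · have h1 := mul_nonneg (hsign x hx) (sq_nonneg (x - r))
          rw [Finset.prod_insert hrS]
          refine h1.trans_eq ?_
          simp only [eval_mul, eval_sub, eval_X, eval_C]
          ring
    · push Not at hroot
      by_cases hpos : ∀ x ∈ Set.Icc u v, 0 ≤ f.eval x
      · exact ⟨∅, 1, Or.inl rfl, by simp, by simpa using hpos⟩
      · refine ⟨∅, -1, Or.inr rfl, by simp, fun y hy => ?_⟩
        push Not at hpos
        obtain ⟨x, hx, hx0⟩ := hpos
        by_contra hcon
        have hy0 : 0 < f.eval y := by simpa using hcon
        obtain ⟨z, hz, hz0⟩ := intermediate_value_uIcc (f.continuous.continuousOn (s := Set.uIcc x y))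
          (Set.mem_uIcc.mpr (Or.inl ⟨hx0.le, hy0.le⟩))
        have hzx : z ≠ x := by rintro rfl; exact hx0.ne hz0
        have hzy : z ≠ y := by rintro rfl; exact hy0.ne' hz0
        refine hroot z ?_ hz0
        rcases Set.mem_uIcc.mp hz with h | h
        · exact ⟨hx.1.trans_lt (lt_of_le_of_ne h.1 hzx.symm),
            (lt_of_le_of_ne h.2 hzy).trans_le hy.2⟩
        · exact ⟨hy.1.trans_lt (lt_of_le_of_ne h.1 hzy.symm),
            (lt_of_le_of_ne h.2 hzx).trans_le hx.2⟩

open Polynomial in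
/-- **Rolle's theorem** for a finite set of zeros. -/
theorem exists_derivative_roots_between (q : ℝ[X]) (S : Finset ℝ) (hS : ∀ x ∈ S, q.eval x = 0)
    (hne : S.Nonempty) :
    ∃ T : Finset ℝ, T.card + 1 = S.card ∧ ∀ t ∈ T, q.derivative.eval t = 0 ∧ t ∉ S ∧
      (∃ x ∈ S, x < t) ∧ ∃ x ∈ S, t < x := by
  induction S using Finset.induction_on_max with
  | empty => exact absurd hne Finset.not_nonempty_empty
  | insert m S hm ih =>
    have hmS : m ∉ S := fun h => lt_irrefl _ (hm m h)
    rcases S.eq_empty_or_nonempty with rfl | hSne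
    · exact ⟨∅, by simp, by simp⟩
    · obtain ⟨T, hcard, hT⟩ := ih (fun x hx => hS x (Finset.mem_insert_of_mem hx)) hSne
      have hMS := S.max'_mem hSne
      obtain ⟨t, ht, ht0⟩ := exists_deriv_eq_zero (hm _ hMS) q.continuous.continuousOn
        ((hS _ (Finset.mem_insert_of_mem hMS)).trans (hS m (Finset.mem_insert_self _ _)).symm)
      rw [Polynomial.deriv] at ht0
      have htT : t ∉ T := by
        intro h
        obtain ⟨x, hx, htx⟩ := (hT t h).2.2.2
        exact (htx.trans_le (S.le_max' x hx)).not_gt ht.1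
      refine ⟨insert t T, ?_, fun z hz => ?_⟩
      · rw [Finset.card_insert_of_notMem htT, Finset.card_insert_of_notMem hmS, hcard]
      · rcases Finset.mem_insert.mp hz with rfl | hz
        · refine ⟨ht0, fun h => ?_, ⟨_, Finset.mem_insert_of_mem hMS, ht.1⟩,
            ⟨m, Finset.mem_insert_self _ _, ht.2⟩⟩
          rcases Finset.mem_insert.mp h with rfl | h
          · exact lt_irrefl _ ht.2
          · exact (S.le_max' z h).not_gt ht.1
        · obtain ⟨h0, h1, ⟨x, hx, hxz⟩, y, hy, hzy⟩ := hT z hz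
          refine ⟨h0, fun h => ?_, ⟨x, Finset.mem_insert_of_mem hx, hxz⟩,
            ⟨y, Finset.mem_insert_of_mem hy, hzy⟩⟩
          rcases Finset.mem_insert.mp h with rfl | h
          · exact (hzy.trans (hm y hy)).false
          · exact h1 h

open Polynomial in
theorem eq_C_leadingCoeff_mul_prod_of_card_ge {f : ℝ[X]} (hf : f ≠ 0) (S : Finset ℝ)
    (hS : ∀ x ∈ S, f.eval x = 0) (hdeg : f.natDegree ≤ S.card) :
    f = C f.leadingCoeff * ∏ x ∈ S, (X - C x) := by
  have hle : S.val ≤ f.roots :=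
    Multiset.le_iff_subset S.nodup |>.mpr fun x hx => (mem_roots hf).mpr (hS x hx)
  have heq : S.val = f.roots :=
    Multiset.eq_of_le_of_card_le hle ((card_roots' f).trans hdeg)
  have hcard : f.roots.card = f.natDegree :=
    le_antisymm (card_roots' f) (by rw [← heq]; exact hdeg)
  have h := C_leadingCoeff_mul_prod_multiset_X_sub_C hcard
  rw [← heq] at h
  exact h.symm

-- Dimension count: `|S| + |T|` linear conditions on a space of dimension `|S| + |T| + 1`.
open Polynomial in
theorem exists_eval_eq_zero_derivative_eval_eq_zero (S T : Finset ℝ) :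
    ∃ q : ℝ[X], q ≠ 0 ∧ q.natDegree ≤ S.card + T.card ∧ (∀ x ∈ S, q.eval x = 0) ∧
      ∀ y ∈ T, q.derivative.eval y = 0 := by
  set N := S.card + T.card with hN
  let F : degreeLT ℝ (N + 1) →ₗ[ℝ] (S → ℝ) × (T → ℝ) :=
    (LinearMap.prod (LinearMap.pi fun x : S => leval (x : ℝ))
      (LinearMap.pi fun y : T => leval (y : ℝ) ∘ₗ derivative)) ∘ₗ (degreeLT ℝ (N + 1)).subtype
  have hfin : Module.finrank ℝ (degreeLT ℝ (N + 1)) = N + 1 := by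
    rw [(degreeLTEquiv ℝ (N + 1)).finrank_eq, Module.finrank_fin_fun]
  have : FiniteDimensional ℝ (degreeLT ℝ (N + 1)) :=
    Module.finite_of_finrank_pos (by rw [hfin]; exact Nat.succ_pos _)
  have hker : LinearMap.ker F ≠ ⊥ := F.ker_ne_bot_of_finrank_lt <| by
    rw [hfin, Module.finrank_prod, Module.finrank_fintype_fun_eq_card,
      Module.finrank_fintype_fun_eq_card, Fintype.card_coe, Fintype.card_coe]
    exact Nat.lt_succ_self _
  obtain ⟨q, hq, hq0⟩ := Submodule.exists_mem_ne_zero_of_ne_bot hker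
  have hF : F q = 0 := hq
  refine ⟨q, fun h => hq0 (Subtype.ext h), ?_, fun x hx => ?_, fun y hy => ?_⟩
  · exact Nat.lt_succ_iff.mp
      ((natDegree_lt_iff_degree_lt fun h => hq0 (Subtype.ext h)).mpr (mem_degreeLT.mp q.2))
  · exact congrFun (congrArg Prod.fst hF) ⟨x, hx⟩
  · exact congrFun (congrArg Prod.snd hF) ⟨y, hy⟩

theorem neg_one_pow_card_mul_prod_sub_pos {T : Finset ℝ} {s : ℝ} (h : ∀ y ∈ T, s < y) :
    0 < (-1) ^ T.card * ∏ y ∈ T, (s - y) := by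
  rw [← Finset.prod_const, ← Finset.prod_mul_distrib]
  exact Finset.prod_pos fun y hy => by linarith [h y hy]

open Polynomial in
/-- Given points `S` in `(a, b)` and `T` in `[b, ∞)`, there is a polynomial of degree at most
`|S| + |T|` that changes sign on `[a, b]` exactly at `S`, and whose derivative changes sign on
`[b, ∞)` exactly at `T`. -/
theorem exists_comparison_polynomial {a b : ℝ} {S T : Finset ℝ} (hSne : S.Nonempty)
    (hS : ∀ x ∈ S, x ∈ Set.Ioo a b) (hT : ∀ y ∈ T, b ≤ y) :
    ∃ q : ℝ[X], q ≠ 0 ∧ q.natDegree ≤ S.card + T.card ∧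
      (∀ y ∈ T, q.derivative.eval y = 0) ∧
      (∀ x ∈ Set.Icc a b, 0 ≤ (-1) ^ T.card * q.eval x * ∏ s ∈ S, (x - s)) ∧
      ∀ x, b ≤ x → 0 ≤ q.derivative.eval x * ∏ y ∈ T, (x - y) := by
  obtain ⟨q, hq0, hqdeg, hqS, hqT⟩ := exists_eval_eq_zero_derivative_eval_eq_zero S T
  have hq' : q.derivative ≠ 0 := by
    intro h
    obtain ⟨x, hx⟩ := hSne
    have hx0 := hqS x hx
    rw [eq_C_of_natDegree_eq_zero (derivative_eq_zero.mp h), eval_C] at hx0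
    exact hq0 (by
      rw [eq_C_of_natDegree_eq_zero (derivative_eq_zero.mp h), hx0, C_0])
  have hqpos : 0 < q.natDegree :=
    Nat.pos_of_ne_zero fun h => hq' (by rw [eq_C_of_natDegree_eq_zero h, derivative_C])
  have hdeg' : q.derivative.natDegree + 1 ≤ S.card + T.card := by
    have := natDegree_derivative_lt hqpos.ne'
    omega
  -- `q'` has degree below `|S| + |T|` and already vanishes on `T`, leaving at most `|S| - 1` zeros
  -- below `b`. Rolle's theorem supplies exactly that many, so `q'` factors completely.
  have hcount : ∀ U : Finset ℝ, (∀ t ∈ U, q.derivative.eval t = 0 ∧ t < b) →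
      U.card < S.card := by
    intro U hU
    have hdisj : Disjoint U T := Finset.disjoint_left.mpr fun t htU htT =>
      (hT t htT).not_gt (hU t htU).2
    have hle : (U ∪ T).card ≤ q.derivative.natDegree := by
      refine (Multiset.card_le_card ?_).trans (card_roots' _)
      refine (Multiset.le_iff_subset (U ∪ T).nodup).mpr fun t ht => (mem_roots hq').mpr ?_
      rcases Finset.mem_union.mp ht with h | h
      · exact (hU t h).1
      · exact hqT t h
    rw [Finset.card_union_of_disjoint hdisj] at hle
    omega
  obtain ⟨U, hUcard, hU⟩ := exists_derivative_roots_between q S hqS hSne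
  have hUb : ∀ t ∈ U, t < S.max' hSne := fun t ht => by
    obtain ⟨x, hx, htx⟩ := (hU t ht).2.2.2
    exact htx.trans_le (S.le_max' x hx)
  have hMb : S.max' hSne < b := (hS _ (S.max'_mem hSne)).2
  have hdisj : Disjoint U T := Finset.disjoint_left.mpr fun t htU htT =>
    (hT t htT).not_gt ((hUb t htU).trans hMb)
  set κ := q.derivative.leadingCoeff with hκ
  have hκ0 : κ ≠ 0 := leadingCoeff_ne_zero.mpr hq'
  have hfact : ∀ x, q.derivative.eval x = κ * ((∏ t ∈ U, (x - t)) * ∏ y ∈ T, (x - y)) := by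
    intro x
    have := eq_C_leadingCoeff_mul_prod_of_card_ge hq' (U ∪ T)
      (fun t ht => (Finset.mem_union.mp ht).elim (fun h => (hU t h).1) (hqT t))
      (by rw [Finset.card_union_of_disjoint hdisj]; omega)
    rw [this, Finset.prod_union hdisj, ← hκ]
    simp [eval_prod]
  obtain ⟨r, hr⟩ : (∏ s ∈ S, (X - C s)) ∣ q :=
    Finset.prod_dvd_of_coprime (fun x _ y _ hxy => isCoprime_X_sub_C_of_isUnit_sub
      (sub_ne_zero.mpr hxy).isUnit) fun s hs => dvd_iff_isRoot.mpr (hqS s hs)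
  have hqr : ∀ x, q.eval x = (∏ s ∈ S, (x - s)) * r.eval x := by
    intro x
    rw [hr]
    simp [eval_prod]
  -- A zero of the cofactor would be a double zero of `q` at a point of `S`, or a zero of `q`
  -- outside `S`; either yields one critical point too many below `b`.
  have hr0 : ∀ t ∈ Set.Icc a b, r.eval t ≠ 0 := by
    intro t ht h0
    by_cases htS : t ∈ S
    · have hprod : eval t (∏ s ∈ S, (X - C s)) = 0 := by
        rw [eval_prod]
        exact Finset.prod_eq_zero htS (by simp)
      have ht0 : q.derivative.eval t = 0 := by
        rw [hr, derivative_mul, eval_add, eval_mul, eval_mul, h0, hprod]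
        ring
      have htU : t ∉ U := fun h => (hU t h).2.1 htS
      have := hcount (insert t U) (by
        intro z hz
        rcases Finset.mem_insert.mp hz with rfl | hz
        · exact ⟨ht0, (hS z htS).2⟩
        · exact ⟨(hU z hz).1, (hUb z hz).trans hMb⟩)
      rw [Finset.card_insert_of_notMem htU] at this
      omega
    · obtain ⟨V, hVcard, hV⟩ := exists_derivative_roots_between q (insert t S) (by
        intro z hz
        rcases Finset.mem_insert.mp hz with rfl | hz
        · rw [hqr, h0, mul_zero]
        · exact hqS z hz) (Finset.insert_nonempty _ _)
      have := hcount V (by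
        intro z hz
        obtain ⟨h1, _, _, x, hx, hzx⟩ := hV z hz
        refine ⟨h1, hzx.trans_le ?_⟩
        rcases Finset.mem_insert.mp hx with rfl | hx
        · exact ht.2
        · exact (hS x hx).2.le)
      rw [Finset.card_insert_of_notMem htS] at hVcard
      omega
  -- The mean value theorem between the last point of `S` and `b` compares the sign of `q` at `b`
  -- with the known sign of `q'` there.
  have hrb : 0 < κ * (-1) ^ T.card * r.eval b := by
    obtain ⟨s, hs, hslope⟩ := exists_deriv_eq_slope (fun x => q.eval x) hMb
      q.continuous.continuousOn q.differentiable.differentiableOn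
    rw [Polynomial.deriv, hqS _ (S.max'_mem hSne), sub_zero, eq_div_iff (sub_pos.mpr hMb).ne',
      hfact, hqr] at hslope
    have h1 : 0 < ∏ x ∈ S, (b - x) := Finset.prod_pos fun x hx => sub_pos.mpr (hS x hx).2
    have h2 : 0 < ∏ t ∈ U, (s - t) :=
      Finset.prod_pos fun t ht => sub_pos.mpr ((hUb t ht).trans hs.1)
    have h3 := neg_one_pow_card_mul_prod_sub_pos (s := s) fun y hy => hs.2.trans_le (hT y hy)
    have h4 : 0 < (∏ x ∈ S, (b - x)) * (κ * (-1) ^ T.card * r.eval b) := by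
      have : (∏ x ∈ S, (b - x)) * (κ * (-1) ^ T.card * r.eval b) = κ ^ 2 * (∏ t ∈ U, (s - t)) *
          ((-1) ^ T.card * ∏ y ∈ T, (s - y)) * (b - S.max' hSne) := by
        linear_combination (-κ * (-1) ^ T.card) * hslope
      rw [this]
      have h5 := sub_pos.mpr hMb
      positivity
    exact pos_of_mul_pos_right h4 h1.le
  have hrpos : ∀ x ∈ Set.Icc a b, 0 < κ * (-1) ^ T.card * r.eval x := by
    intro x hx
    by_contra hcon
    obtain ⟨z, hz, hz0⟩ := intermediate_value_Icc hx.2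
      (f := fun y => κ * (-1) ^ T.card * r.eval y) (by fun_prop) ⟨not_lt.mp hcon, hrb.le⟩
    refine hr0 z ⟨hx.1.trans hz.1, hz.2⟩ ((mul_eq_zero.mp hz0).resolve_left ?_)
    exact mul_ne_zero hκ0 (pow_ne_zero _ (by norm_num))
  refine ⟨C κ * q, mul_ne_zero (C_ne_zero.mpr hκ0) hq0, (natDegree_C_mul_le _ _).trans hqdeg,
    fun y hy => ?_, fun x hx => ?_, fun x hx => ?_⟩
  · rw [derivative_C_mul, eval_C_mul, hqT y hy, mul_zero]
  · rw [eval_C_mul, hqr]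
    have h1 := mul_nonneg (hrpos x hx).le (sq_nonneg (∏ s ∈ S, (x - s)))
    refine h1.trans_eq ?_
    ring
  · rw [derivative_C_mul, eval_C_mul, hfact]
    have h1 : 0 ≤ ∏ t ∈ U, (x - t) :=
      Finset.prod_nonneg fun t ht => by linarith [hUb t ht]
    have h2 : κ * (κ * ((∏ t ∈ U, (x - t)) * ∏ y ∈ T, (x - y))) * ∏ y ∈ T, (x - y)
        = κ ^ 2 * (∏ t ∈ U, (x - t)) * (∏ y ∈ T, (x - y)) ^ 2 := by ring
    rw [h2]
    positivity

/-! ### Critical points of sign-extremal polynomials -/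

open Polynomial in
/-- No nonzero polynomial of smaller degree agrees in sign with `f` on `[a, b]` while its
derivative agrees in sign with that of `f` on `[c, d]`. -/
def IsSignExtremal (a b c d : ℝ) (f : ℝ[X]) : Prop :=
  ∀ q : ℝ[X], q ≠ 0 → q.natDegree < f.natDegree →
    (∀ x ∈ Set.Icc a b, 0 ≤ f.eval x * q.eval x) →
    ¬ ∀ x ∈ Set.Icc c d, 0 ≤ f.derivative.eval x * q.derivative.eval x

open Polynomial in
/-- The critical points of a sign-extremal polynomial are real, simple, and lie to the right of one
of its zeros in `(a, b)`. -/
theorem IsSignExtremal.exists_derivative_roots {a b c d : ℝ} {f : ℝ[X]}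
    (hf : IsSignExtremal a b c d f) (hbc : b ≤ c) (hcd : c ≤ d) (hdeg : 0 < f.natDegree) :
    ∃ x₁ ∈ Set.Ioo a b, f.eval x₁ = 0 ∧ ∃ Z : Finset ℝ, f.natDegree ≤ Z.card + 1 ∧
      ∀ z ∈ Z, f.derivative.eval z = 0 ∧ x₁ ≤ z ∧ z ≤ d := by
  have hf0 : f ≠ 0 := by rintro rfl; simp at hdeg
  have hf' : f.derivative ≠ 0 := fun h =>
    hdeg.ne' (derivative_eq_zero.mp h)
  obtain ⟨S, σ, hσ, hS, hSsign⟩ := exists_sign_changes a b f hf0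
  obtain ⟨T, τ, hτ, hT, hTsign⟩ := exists_sign_changes c d f.derivative hf'
  have hσ2 : σ * σ = 1 := by rcases hσ with rfl | rfl <;> norm_num
  have hτ2 : τ * τ = 1 := by rcases hτ with rfl | rfl <;> norm_num
  -- Without sign changes the constant `σ` would be a forbidden test polynomial.
  have hSne : S.Nonempty := by
    rw [Finset.nonempty_iff_ne_empty]
    rintro rfl
    refine hf (C σ) (C_ne_zero.mpr fun h => by simp [h] at hσ2) (by simpa using hdeg)
      (fun x hx => ?_) (by simp)
    have := hSsign x hx
    rw [Finset.prod_empty, mul_one] at this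
    rw [eval_C]
    linarith
  -- The parity condition matches the sign of `f` on `[a, b]` with that of `f'` on `[c, d]`, so a
  -- single factor `τ` aligns the comparison polynomial with both.
  have hcount : ∀ T' : Finset ℝ, σ * (-1) ^ T'.card = τ → (∀ y ∈ T', b ≤ y) →
      (∀ x ∈ Set.Icc c d, 0 ≤ τ * f.derivative.eval x * ∏ y ∈ T', (x - y)) →
      f.natDegree ≤ S.card + T'.card := by
    intro T' hpar hT'b hT'sign
    by_contra hlt
    obtain ⟨q, hq0, hqdeg, hqT, hqS, hqT'⟩ :=
      exists_comparison_polynomial hSne (fun x hx => (hS x hx).1) hT'b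
    refine hf (C τ * q) (mul_ne_zero (C_ne_zero.mpr fun h => by simp [h] at hτ2) hq0)
      (((natDegree_C_mul_le _ _).trans hqdeg).trans_lt (not_le.mp hlt)) (fun x hx => ?_)
      fun x hx => ?_
    · rw [eval_C_mul]
      by_cases hP : ∏ s ∈ S, (x - s) = 0
      · obtain ⟨s, hs, hxs⟩ := Finset.prod_eq_zero_iff.mp hP
        rw [sub_eq_zero.mp hxs, (hS s hs).2, zero_mul]
      · refine nonneg_of_mul_nonneg_left ?_ (sq_pos_of_ne_zero hP)
        refine (mul_nonneg (hSsign x hx) (hqS x hx)).trans_eq ?_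
        rw [← hpar]
        ring
    · rw [derivative_C_mul, eval_C_mul]
      by_cases hP : ∏ y ∈ T', (x - y) = 0
      · obtain ⟨y, hy, hxy⟩ := Finset.prod_eq_zero_iff.mp hP
        rw [sub_eq_zero.mp hxy, hqT y hy, mul_zero, mul_zero]
      · refine nonneg_of_mul_nonneg_left ?_ (sq_pos_of_ne_zero hP)
        refine (mul_nonneg (hT'sign x hx) (hqT' x (hbc.trans hx.1))).trans_eq ?_
        ring
  obtain ⟨U, hUcard, hU⟩ := exists_derivative_roots_between f S (fun x hx => (hS x hx).2) hSne
  have hMb : S.max' hSne < b := (hS _ (S.max'_mem hSne)).1.2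
  have hminmax : S.min' hSne ≤ S.max' hSne := S.min'_le _ (S.max'_mem hSne)
  have hUlt : ∀ t ∈ U, S.min' hSne < t ∧ t < S.max' hSne := fun t ht => by
    obtain ⟨_, _, ⟨x, hx, hxt⟩, y, hy, hty⟩ := hU t ht
    exact ⟨(S.min'_le x hx).trans_lt hxt, hty.trans_le (S.le_max' y hy)⟩
  have hTgt : ∀ t ∈ T, c < t := fun t ht => (hT t ht).1.1
  have hdisj : Disjoint U T := Finset.disjoint_left.mpr fun t htU htT => by
    linarith [hUlt t htU, hTgt t htT]
  have hUT : ∀ z ∈ U ∪ T, f.derivative.eval z = 0 ∧ S.min' hSne ≤ z ∧ z ≤ d := by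
    intro z hz
    rcases Finset.mem_union.mp hz with h | h
    · exact ⟨(hU z h).1, (hUlt z h).1.le, by linarith [(hUlt z h).2]⟩
    · exact ⟨(hT z h).2, by linarith [hTgt z h], (hT z h).1.2.le⟩
  refine ⟨S.min' hSne, (hS _ (S.min'_mem hSne)).1, (hS _ (S.min'_mem hSne)).2, ?_⟩
  by_cases hpar : σ * (-1) ^ T.card = τ
  · have := hcount T hpar (fun y hy => hbc.trans (hTgt y hy).le) hTsign
    refine ⟨U ∪ T, ?_, hUT⟩
    rw [Finset.card_union_of_disjoint hdisj]
    omega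
  · have hpar' : σ * (-1) ^ T.card = -τ := by
      rcases hσ with rfl | rfl <;> rcases hτ with rfl | rfl <;>
        rcases neg_one_pow_eq_or ℝ T.card with h | h <;> simp_all
    have hcT : c ∉ T := fun h => lt_irrefl _ (hTgt c h)
    have hcardT : (insert c T).card = T.card + 1 := Finset.card_insert_of_notMem hcT
    -- Adding the endpoint `c` corrects the parity without spoiling the sign, since `x - c ≥ 0` on
    -- `[c, d]`. The bound worsens by one, which the extra critical point `z` below makes up for.
    have hle := hcount (insert c T) (by rw [hcardT, pow_succ]; linear_combination -hpar')
      (fun y hy => by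
        rcases Finset.mem_insert.mp hy with rfl | hy
        · exact hbc
        · exact hbc.trans (hTgt y hy).le)
      (fun x hx => by
        rw [Finset.prod_insert hcT]
        refine (mul_nonneg (hTsign x hx) (sub_nonneg.mpr hx.1)).trans_eq ?_
        ring)
    -- Just after its last sign change `σ f` becomes positive, so `σ f'` is positive somewhere
    -- before `b`; the wrong parity makes it nonpositive at `c`.
    obtain ⟨z, hz, hz0⟩ : ∃ z ∈ Set.Ioc (S.max' hSne) c, f.derivative.eval z = 0 := by
      by_contra! hne
      obtain ⟨t, ht, ht0⟩ : ∃ t ∈ Set.Ioo (S.max' hSne) b, f.eval t ≠ 0 := by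
        by_contra! h
        exact hf0 (eq_zero_of_infinite_isRoot f ((Set.Ioo_infinite hMb).mono h))
      have hσt : 0 < σ * f.eval t := by
        have h1 := hSsign t ⟨(hS _ (S.max'_mem hSne)).1.1.le.trans ht.1.le, ht.2.le⟩
        have h2 : 0 < ∏ s ∈ S, (t - s) :=
          Finset.prod_pos fun s hs => sub_pos.mpr ((S.le_max' s hs).trans_lt ht.1)
        refine lt_of_le_of_ne (nonneg_of_mul_nonneg_left h1 h2) (mul_ne_zero ?_ ht0).symm
        rintro rfl
        simp at hσ2
      obtain ⟨s, hs, hslope⟩ := exists_deriv_eq_slope (fun x => f.eval x) ht.1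
        f.continuous.continuousOn f.differentiable.differentiableOn
      rw [Polynomial.deriv, (hS _ (S.max'_mem hSne)).2, sub_zero] at hslope
      have hσs : 0 < σ * f.derivative.eval s := by
        rw [hslope, ← mul_div_assoc]
        exact div_pos hσt (sub_pos.mpr ht.1)
      have hσc : σ * f.derivative.eval c ≤ 0 := by
        have h1 := hTsign c ⟨le_rfl, hcd⟩
        have h2 := neg_one_pow_card_mul_prod_sub_pos hTgt
        refine nonpos_of_mul_nonpos_left ?_ h2
        have h3 : σ * f.derivative.eval c * ((-1) ^ T.card * ∏ y ∈ T, (c - y))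
            = -(τ * f.derivative.eval c * ∏ y ∈ T, (c - y)) := by
          linear_combination (f.derivative.eval c * ∏ y ∈ T, (c - y)) * hpar'
        rw [h3]
        exact neg_nonpos.mpr h1
      have hsc : s ≤ c := (hs.2.trans ht.2).le.trans hbc
      obtain ⟨z, hz, hz0⟩ := intermediate_value_Icc' hsc
        (f := fun y => σ * f.derivative.eval y) (by fun_prop) ⟨hσc, hσs.le⟩
      refine hne z ⟨hs.1.trans_le hz.1, hz.2⟩ ((mul_eq_zero.mp hz0).resolve_left ?_)
      rintro rfl
      simp at hσ2
    have hzT : z ∉ U ∪ T := fun h => by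
      rcases Finset.mem_union.mp h with h | h
      · exact (hUlt z h).2.not_gt hz.1
      · exact (hTgt z h).not_ge hz.2
    refine ⟨insert z (U ∪ T), ?_, fun y hy => ?_⟩
    · rw [Finset.card_insert_of_notMem hzT, Finset.card_union_of_disjoint hdisj]
      omega
    · rcases Finset.mem_insert.mp hy with rfl | hy
      · exact ⟨hz0, hminmax.trans hz.1.le, hz.2.trans hcd⟩
      · exact hUT y hy

/-! ### First variation and reality of the extremal polynomial -/

theorem Continuous.integrable_of_support_subset_Icc {μ : Measure ℝ} [IsFiniteMeasure μ] {u v : ℝ}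
    (hμ : μ.support ⊆ Set.Icc u v) {f : ℝ → ℝ} (hf : Continuous f) : Integrable f μ := by
  have h : μ.restrict (Set.Icc u v) = μ :=
    Measure.restrict_eq_self_of_ae_mem (Filter.mem_of_superset Measure.support_mem_ae hμ)
  rw [← h]
  exact hf.continuousOn.integrableOn_compact isCompact_Icc

open Polynomial in
theorem eq_zero_of_ae_eval_eq_zero {μ : Measure ℝ} (hinf : μ.support.Infinite) {f : ℝ[X]}
    (hf : ∀ᵐ x ∂μ, f.eval x = 0) : f = 0 := by
  refine eq_zero_of_infinite_isRoot f (hinf.mono ?_)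
  exact Measure.support_subset_of_isClosed (isClosed_singleton.preimage f.continuous) hf

/-- For `p < 2` the power `‖y‖ ^ (p - 2)` blows up near `0`; the factor `y` tames it, giving the
first variation a continuous bound. -/
theorem norm_norm_rpow_sub_two_mul {p : ℝ} (hp : 1 < p) (y : ℝ) :
    ‖‖y‖ ^ (p - 2) * y‖ = ‖y‖ ^ (p - 1) := by
  rcases eq_or_ne y 0 with rfl | hy
  · rw [mul_zero, norm_zero, Real.zero_rpow (by linarith)]
  · rw [norm_mul, Real.norm_of_nonneg (Real.rpow_nonneg (norm_nonneg y) _),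
      ← Real.rpow_add_one (norm_ne_zero_iff.mpr hy)]
    ring_nf

/-- The first variation of `∫ ‖u‖ ^ p` in the direction `v`. -/
theorem hasDerivAt_integral_norm_rpow {μ : Measure ℝ} [IsFiniteMeasure μ] {l r : ℝ}
    (hμ : μ.support ⊆ Set.Icc l r) {p : ℝ} (hp : 1 < p) {u v : ℝ → ℝ} (hu : Continuous u)
    (hv : Continuous v) :
    Integrable (fun x => p * ‖u x‖ ^ (p - 2) * u x * v x) μ ∧
      HasDerivAt (fun t : ℝ => ∫ x, ‖u x + t * v x‖ ^ p ∂μ)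
        (∫ x, p * ‖u x‖ ^ (p - 2) * u x * v x ∂μ) 0 := by
  have hp0 : 0 ≤ p := by linarith
  have hp1 : 0 ≤ p - 1 := by linarith
  have hcont : ∀ t : ℝ, Continuous fun x => ‖u x + t * v x‖ ^ p := fun t =>
    Continuous.rpow_const (by fun_prop) fun _ => Or.inr hp0
  have hmeas : ∀ t : ℝ, Measurable fun x =>
      p * ‖u x + t * v x‖ ^ (p - 2) * (u x + t * v x) * v x := by
    intro t
    have := hu.measurable
    have := hv.measurable
    fun_prop
  have hbound : Continuous fun x => p * (‖u x‖ + ‖v x‖) ^ (p - 1) * ‖v x‖ :=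
    ((continuous_const.mul (Continuous.rpow_const (by fun_prop) fun _ => Or.inr hp1)).mul hv.norm)
  have key := hasDerivAt_integral_of_dominated_loc_of_deriv_le
    (F := fun (t : ℝ) x => ‖u x + t * v x‖ ^ p)
    (F' := fun (t : ℝ) x => p * ‖u x + t * v x‖ ^ (p - 2) * (u x + t * v x) * v x)
    (bound := fun x => p * (‖u x‖ + ‖v x‖) ^ (p - 1) * ‖v x‖) (μ := μ) (x₀ := (0 : ℝ))
    (Metric.ball_mem_nhds 0 one_pos)
    (Filter.Eventually.of_forall fun t => (hcont t).aestronglyMeasurable)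
    ((hcont 0).integrable_of_support_subset_Icc hμ)
    (hmeas 0).aestronglyMeasurable
    (Filter.Eventually.of_forall fun x t ht => ?_)
    (hbound.integrable_of_support_subset_Icc hμ)
    (Filter.Eventually.of_forall fun x t _ => ?_)
  · simpa using key
  · rw [mul_assoc p, norm_mul, norm_mul, norm_norm_rpow_sub_two_mul hp, Real.norm_of_nonneg hp0]
    have ht1 : ‖t‖ ≤ 1 := by simpa using (mem_ball_zero_iff.mp ht).le
    have h1 : ‖u x + t * v x‖ ≤ ‖u x‖ + ‖v x‖ := by
      refine (norm_add_le _ _).trans (add_le_add le_rfl ?_)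
      rw [norm_mul]
      exact mul_le_of_le_one_left (norm_nonneg _) ht1
    gcongr
  · have h1 : HasDerivAt (fun t : ℝ => u x + t * v x) (v x) t := by
      simpa using ((hasDerivAt_id t).mul_const (v x)).const_add (u x)
    exact (hasDerivAt_norm_rpow (u x + t * v x) hp).comp t h1

open Polynomial in
theorem exists_eq_map_add_I_mul_map (f : ℂ[X]) :
    ∃ R J : ℝ[X], f = R.map Complex.ofRealHom + C Complex.I * J.map Complex.ofRealHom := by
  induction f using Polynomial.induction_on' with
  | add f g hf hg =>
    obtain ⟨R, J, rfl⟩ := hf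
    obtain ⟨R', J', rfl⟩ := hg
    refine ⟨R + R', J + J', ?_⟩
    rw [Polynomial.map_add, Polynomial.map_add]
    ring
  | monomial n a =>
    refine ⟨monomial n a.re, monomial n a.im, ?_⟩
    rw [map_monomial, map_monomial, C_mul_monomial, ← map_add]
    congr 1
    rw [mul_comm]
    exact (Complex.re_add_im a).symm

open Polynomial in
theorem norm_eval_map_ofReal (f : ℝ[X]) (x : ℝ) :
    ‖(f.map Complex.ofRealHom).eval (x : ℂ)‖ = ‖f.eval x‖ := by
  have h : (f.map Complex.ofRealHom).eval (x : ℂ) = ((f.eval x : ℝ) : ℂ) :=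
    eval_map_apply Complex.ofRealHom x
  rw [h, Complex.norm_real]

open Polynomial in
theorem norm_eval_map_add_I_mul_sq (R J : ℝ[X]) (x : ℝ) :
    ‖(R.map Complex.ofRealHom + C Complex.I * J.map Complex.ofRealHom).eval (x : ℂ)‖ ^ 2
      = ‖R.eval x‖ ^ 2 + ‖J.eval x‖ ^ 2 := by
  have h : ∀ f : ℝ[X], (f.map Complex.ofRealHom).eval (x : ℂ) = ((f.eval x : ℝ) : ℂ) :=
    fun f => eval_map_apply Complex.ofRealHom x
  rw [eval_add, eval_C_mul, h, h, ← Complex.normSq_eq_norm_sq, Complex.normSq_apply]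
  simp
  ring

open Polynomial in
theorem continuous_norm_eval_rpow {p : ℝ} (hp : 0 ≤ p) (f : ℂ[X]) :
    Continuous fun x : ℝ => ‖f.eval (x : ℂ)‖ ^ p :=
  Continuous.rpow_const ((f.continuous.comp Complex.continuous_ofReal).norm) fun _ => Or.inr hp

open Polynomial in
theorem sobolevNorm_le_iff {p : ℝ} (hp : 1 < p) (μ₀ μ₁ : Measure ℝ) (f g : ℂ[X]) :
    sobolevNorm p μ₀ μ₁ f ≤ sobolevNorm p μ₀ μ₁ g ↔
      (∫ x : ℝ, ‖f.eval (x : ℂ)‖ ^ p ∂μ₀) + ∫ x : ℝ, ‖f.derivative.eval (x : ℂ)‖ ^ p ∂μ₁ ≤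
      (∫ x : ℝ, ‖g.eval (x : ℂ)‖ ^ p ∂μ₀) + ∫ x : ℝ, ‖g.derivative.eval (x : ℂ)‖ ^ p ∂μ₁ := by
  have hnn : ∀ (μ : Measure ℝ) (h : ℂ[X]), 0 ≤ ∫ x : ℝ, ‖h.eval (x : ℂ)‖ ^ p ∂μ := fun μ h =>
    integral_nonneg fun x => Real.rpow_nonneg (norm_nonneg _) _
  exact Real.rpow_le_rpow_iff (add_nonneg (hnn _ _) (hnn _ _)) (add_nonneg (hnn _ _) (hnn _ _))
    (by positivity)

open Polynomial in
/-- A monic extremal polynomial has real coefficients. -/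
theorem IsMonicExtremal.exists_eq_map {p : ℝ} (hp : 1 < p) {a b c d : ℝ} {μ₀ μ₁ : Measure ℝ}
    [IsFiniteMeasure μ₀] [IsFiniteMeasure μ₁] (hμ₀ : μ₀.support ⊆ Set.Icc a b)
    (hμ₁ : μ₁.support ⊆ Set.Icc c d) (hinf : μ₀.support.Infinite) {n : ℕ} {L : ℂ[X]}
    (hL : IsMonicExtremal p μ₀ μ₁ n L) :
    ∃ f : ℝ[X], f.Monic ∧ f.natDegree = n ∧ L = f.map Complex.ofRealHom := by
  obtain ⟨hmonic, hdeg, hmin⟩ := hL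
  obtain ⟨R, J, hRJ⟩ := exists_eq_map_add_I_mul_map L
  have hp0 : 0 < p := by linarith
  have hcoeff : ∀ k, R.coeff k = (L.coeff k).re := by
    intro k
    rw [hRJ]
    simp
  have hRle : R.natDegree ≤ n := natDegree_le_iff_coeff_eq_zero.mpr fun k hk => by
    rw [hcoeff, coeff_eq_zero_of_natDegree_lt (hdeg ▸ hk), Complex.zero_re]
  have hRn : R.coeff n = 1 := by
    rw [hcoeff, ← hdeg, coeff_natDegree, hmonic.leadingCoeff, Complex.one_re]
  have hRmonic : R.Monic := monic_of_natDegree_le_of_coeff_eq_one n hRle hRn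
  have hRdeg : R.natDegree = n :=
    le_antisymm hRle (le_natDegree_of_ne_zero (by rw [hRn]; exact one_ne_zero))
  refine ⟨R, hRmonic, hRdeg, ?_⟩
  -- On the real line `|L|² = R² + J²`, and likewise for derivatives, so `Q` is a competitor that is
  -- pointwise no larger. Minimality forces equality `μ₀`-almost everywhere, and infinite support
  -- gives `J = 0`.
  set Q := R.map Complex.ofRealHom with hQ
  have hle := (sobolevNorm_le_iff hp μ₀ μ₁ L Q).mp
    (hmin Q (hRmonic.map _) (by rw [hQ, natDegree_map, hRdeg]))
  have hL' : derivative L = (derivative R).map Complex.ofRealHom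
      + C Complex.I * (derivative J).map Complex.ofRealHom := by
    rw [hRJ, derivative_add, derivative_C_mul, derivative_map, derivative_map]
  have hpt : ∀ (A B : ℝ[X]) (x : ℝ), ‖(A.map Complex.ofRealHom).eval (x : ℂ)‖ ^ p ≤
      ‖(A.map Complex.ofRealHom + C Complex.I * B.map Complex.ofRealHom).eval (x : ℂ)‖ ^ p := by
    intro A B x
    refine Real.rpow_le_rpow (norm_nonneg _) ?_ hp0.le
    refine le_of_sq_le_sq ?_ (norm_nonneg _)
    rw [norm_eval_map_add_I_mul_sq, norm_eval_map_ofReal]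
    exact le_add_of_nonneg_right (sq_nonneg _)
  have hint₀ : ∀ g : ℂ[X], Integrable (fun x : ℝ => ‖g.eval (x : ℂ)‖ ^ p) μ₀ := fun g =>
    (continuous_norm_eval_rpow hp0.le g).integrable_of_support_subset_Icc hμ₀
  have hint₁ : ∀ g : ℂ[X], Integrable (fun x : ℝ => ‖g.eval (x : ℂ)‖ ^ p) μ₁ := fun g =>
    (continuous_norm_eval_rpow hp0.le g).integrable_of_support_subset_Icc hμ₁
  have hle₁ : ∫ x : ℝ, ‖Q.derivative.eval (x : ℂ)‖ ^ p ∂μ₁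
      ≤ ∫ x : ℝ, ‖L.derivative.eval (x : ℂ)‖ ^ p ∂μ₁ := by
    refine integral_mono (hint₁ _) (hint₁ _) fun x => ?_
    rw [hL', hQ, derivative_map]
    exact hpt _ _ x
  have hle₀ : ∀ x : ℝ, ‖Q.eval (x : ℂ)‖ ^ p ≤ ‖L.eval (x : ℂ)‖ ^ p := fun x => by
    rw [hRJ]
    exact hpt _ _ x
  have hzero : ∫ x : ℝ, (‖L.eval (x : ℂ)‖ ^ p - ‖Q.eval (x : ℂ)‖ ^ p) ∂μ₀ = 0 := by
    refine le_antisymm ?_ (integral_nonneg fun x => sub_nonneg.mpr (hle₀ x))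
    rw [integral_sub (hint₀ _) (hint₀ _)]
    linarith
  have hae := (integral_eq_zero_iff_of_nonneg (fun x => sub_nonneg.mpr (hle₀ x))
    ((hint₀ L).sub (hint₀ Q))).mp hzero
  have hJ : J = 0 := by
    refine eq_zero_of_ae_eval_eq_zero hinf (hae.mono fun x hx => ?_)
    have h1 : ‖L.eval (x : ℂ)‖ = ‖Q.eval (x : ℂ)‖ :=
      (Real.rpow_left_inj (norm_nonneg _) (norm_nonneg _) hp0.ne').mp (sub_eq_zero.mp hx)
    have h2 := norm_eval_map_add_I_mul_sq R J x
    rw [← hRJ, h1, hQ, norm_eval_map_ofReal] at h2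
    exact norm_eq_zero.mp (pow_eq_zero_iff two_ne_zero |>.mp (by linarith))
  rw [hRJ, hJ, Polynomial.map_zero, mul_zero, add_zero]

-- Since `q` has lower degree, `f + t q` stays monic, so the derivative of its `p`th power norm
-- vanishes at `t = 0`. Under the sign conditions both integrals in it are nonnegative, so `f q = 0`
-- holds `μ₀`-almost everywhere, hence identically.
open Polynomial in
theorem IsMonicExtremal.isSignExtremal {p : ℝ} (hp : 1 < p) {a b c d : ℝ} {μ₀ μ₁ : Measure ℝ}
    [IsFiniteMeasure μ₀] [IsFiniteMeasure μ₁] (hμ₀ : μ₀.support ⊆ Set.Icc a b)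
    (hμ₁ : μ₁.support ⊆ Set.Icc c d) (hinf : μ₀.support.Infinite) {n : ℕ} {f : ℝ[X]}
    (hL : IsMonicExtremal p μ₀ μ₁ n (f.map Complex.ofRealHom)) :
    IsSignExtremal a b c d f := by
  obtain ⟨hmonic, hdeg, hmin⟩ := hL
  rw [natDegree_map] at hdeg
  have hf : f.Monic := monic_map_iff.mp hmonic
  intro q hq hqdeg h₀ h₁
  have hp0 : 0 < p := by linarith
  obtain ⟨hi₀, hd₀⟩ := hasDerivAt_integral_norm_rpow hμ₀ hp f.continuous q.continuous
  obtain ⟨-, hd₁⟩ := hasDerivAt_integral_norm_rpow hμ₁ hp f.derivative.continuous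
    q.derivative.continuous
  have hlocmin : IsLocalMin (fun t : ℝ => (∫ x, ‖f.eval x + t * q.eval x‖ ^ p ∂μ₀)
      + ∫ x, ‖f.derivative.eval x + t * q.derivative.eval x‖ ^ p ∂μ₁) 0 := by
    refine Filter.Eventually.of_forall fun t => ?_
    have hdeglt : (C t * q).degree < f.degree :=
      degree_lt_degree ((natDegree_C_mul_le t q).trans_lt hqdeg)
    have h := (sobolevNorm_le_iff hp μ₀ μ₁ _ _).mp
      (hmin ((f + C t * q).map Complex.ofRealHom) ((hf.add_of_left hdeglt).map _)
        (by rw [natDegree_map, natDegree_add_eq_left_of_degree_lt hdeglt, hdeg]))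
    simp only [derivative_map, norm_eval_map_ofReal] at h
    simpa using h
  have hderiv := hlocmin.hasDerivAt_eq_zero (hd₀.add hd₁)
  have hpos : ∀ y z : ℝ, 0 ≤ y * z → 0 ≤ p * ‖y‖ ^ (p - 2) * y * z := fun y z h => by
    rw [mul_assoc (p * ‖y‖ ^ (p - 2))]
    exact mul_nonneg (mul_nonneg hp0.le (Real.rpow_nonneg (norm_nonneg _) _)) h
  have hae₀ : ∀ᵐ x ∂μ₀, x ∈ Set.Icc a b := Filter.mem_of_superset Measure.support_mem_ae hμ₀
  have hae₁ : ∀ᵐ x ∂μ₁, x ∈ Set.Icc c d := Filter.mem_of_superset Measure.support_mem_ae hμ₁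
  have hnn₀ : ∀ᵐ x ∂μ₀, 0 ≤ p * ‖f.eval x‖ ^ (p - 2) * f.eval x * q.eval x :=
    hae₀.mono fun x hx => hpos _ _ (h₀ x hx)
  have hnn₁ := integral_nonneg_of_ae (hae₁.mono fun x hx => hpos _ _ (h₁ x hx))
  have hzero := le_antisymm (by linarith) (integral_nonneg_of_ae hnn₀)
  have hae := (integral_eq_zero_iff_of_nonneg_ae hnn₀ hi₀).mp hzero
  refine mul_ne_zero hf.ne_zero hq (eq_zero_of_ae_eval_eq_zero hinf (hae.mono fun x hx => ?_))
  rw [eval_mul]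
  by_cases hfx : f.eval x = 0
  · rw [hfx, zero_mul]
  · have : p * ‖f.eval x‖ ^ (p - 2) ≠ 0 :=
      mul_ne_zero hp0.ne' (Real.rpow_pos_of_pos (norm_pos_iff.mpr hfx) _).ne'
    refine (mul_eq_zero.mp ?_).resolve_left this
    rw [← mul_assoc]
    exact hx

/-! ### Location of the zeros -/

open Polynomial in
theorem IsSignExtremal.root_mem_ball {a b c d : ℝ} {f : ℝ[X]} (hf : IsSignExtremal a b c d f)
    (hbc : b ≤ c) (hcd : c ≤ d) (hf0 : f ≠ 0) {z : ℂ}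
    (hz : (f.map Complex.ofRealHom).eval z = 0) :
    z ∈ Metric.ball (d : ℂ) (d - a) := by
  have hdeg : 0 < f.natDegree := by
    refine Nat.pos_of_ne_zero fun h => hf0 ?_
    rw [eq_C_of_natDegree_eq_zero h, Polynomial.map_C, eval_C] at hz
    rw [eq_C_of_natDegree_eq_zero h, (Complex.ofReal_eq_zero.mp hz : f.coeff 0 = 0), C_0]
  have hf' : f.derivative ≠ 0 := fun h => hdeg.ne' (derivative_eq_zero.mp h)
  obtain ⟨x₁, hx₁, hx₁0, Z, hZcard, hZ⟩ := hf.exists_derivative_roots hbc hcd hdeg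
  have hfact := eq_C_leadingCoeff_mul_prod_of_card_ge hf' Z (fun y hy => (hZ y hy).1)
    (by have := natDegree_derivative_lt hdeg.ne'; omega)
  by_contra hball
  rw [Metric.mem_ball, dist_eq_norm, not_lt] at hball
  have hne : (x₁ : ℂ) ≠ z := by
    rintro rfl
    rw [← Complex.ofReal_sub, Complex.norm_real, Real.norm_eq_abs, abs_sub_comm,
      abs_of_nonneg (by linarith [hx₁.2])] at hball
    linarith [hx₁.1]
  have hx₁map : (f.map Complex.ofRealHom).eval (x₁ : ℂ) = 0 := by
    rw [show (x₁ : ℂ) = Complex.ofRealHom x₁ from rfl, eval_map_apply, hx₁0, map_zero]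
  obtain ⟨y, hy, hle⟩ := exists_derivative_root_norm_sub_le hne (hx₁map.trans hz.symm) (by
    rw [derivative_map]
    exact (Polynomial.map_ne_zero_iff Complex.ofRealHom.injective).mpr hf')
  rw [derivative_map, hfact, IsRoot, Polynomial.map_mul, Polynomial.map_C, Polynomial.map_prod,
    eval_mul, eval_C, eval_prod, mul_eq_zero, or_iff_right
      ((_root_.map_ne_zero _).mpr (leadingCoeff_ne_zero.mpr hf')), Finset.prod_eq_zero_iff] at hy
  obtain ⟨t, ht, hyt⟩ := hy
  have hyt : y = t := by
    rw [Polynomial.map_sub, Polynomial.map_X, Polynomial.map_C, eval_sub, eval_X, eval_C,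
      sub_eq_zero] at hyt
    exact hyt
  obtain ⟨-, ht1, ht2⟩ := hZ t ht
  rw [hyt, ← Complex.ofReal_sub, Complex.norm_real, Real.norm_of_nonneg (sub_nonneg.mpr ht1)]
    at hle
  -- The critical point `t` lies in `[x₁, d]`, so the two distances add up to at most `(t - x₁) + (d
  -- - t) = d - x₁`.
  have htri := norm_sub_le_norm_sub_add_norm_sub z (t : ℂ) (d : ℂ)
  rw [← Complex.ofReal_sub, Complex.norm_real, Real.norm_eq_abs, abs_sub_comm t d,
    abs_of_nonneg (sub_nonneg.mpr ht2), norm_sub_rev z (t : ℂ)] at htri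
  linarith [hx₁.1]

-- Reflection negates both derivatives, so the sign of their product is kept.
open Polynomial in
theorem IsSignExtremal.comp_neg_X {a b c d : ℝ} {f : ℝ[X]} (hf : IsSignExtremal a b c d f) :
    IsSignExtremal (-b) (-a) (-d) (-c) (f.comp (-X)) := by
  intro q hq hqdeg h₀ h₁
  have hnat : ∀ g : ℝ[X], (g.comp (-X)).natDegree = g.natDegree := fun g => by
    rw [natDegree_comp, natDegree_neg, natDegree_X, mul_one]
  rw [hnat] at hqdeg
  refine hf (q.comp (-X)) (fun h => hq ?_) ((hnat q).trans_lt hqdeg) (fun x hx => ?_)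
    fun x hx => ?_
  · have := congrArg (fun g : ℝ[X] => g.comp (-X)) h
    simpa [comp_assoc] using this
  · simpa using h₀ (-x) ⟨neg_le_neg hx.2, neg_le_neg hx.1⟩
  · simpa [derivative_comp] using h₁ (-x) ⟨neg_le_neg hx.2, neg_le_neg hx.1⟩

theorem corollary3 (p : ℝ) (hp : 1 < p) (a b c d : ℝ) (hab : a < b) (hcd : c ≤ d)
    (hdisj : interior (Set.Icc a b) ∩ interior (Set.Icc c d) = ∅)
    (μ₀ μ₁ : Measure ℝ) [IsFiniteMeasure μ₀] [IsFiniteMeasure μ₁]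
    (hμ₀ : μ₀.support ⊆ Set.Icc a b) (hμ₁ : μ₁.support ⊆ Set.Icc c d)
    (hinf : μ₀.support.Infinite)
    (n : ℕ) (L : Polynomial ℂ) (hL : IsMonicExtremal p μ₀ μ₁ n L) :
    (b ≤ c → ∀ z : ℂ, L.IsRoot z →
      z ∈ Metric.ball (d : ℂ) (d - a) ∪ Metric.ball (a : ℂ) (b - a)) ∧
    (d ≤ a → ∀ z : ℂ, L.IsRoot z →
      z ∈ Metric.ball (c : ℂ) (b - c) ∪ Metric.ball (b : ℂ) (b - a)) := by
  obtain ⟨f, hf, -, rfl⟩ := hL.exists_eq_map hp hμ₀ hμ₁ hinf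
  have hsign := hL.isSignExtremal hp hμ₀ hμ₁ hinf
  -- In both cases the first disc alone contains every zero.
  refine ⟨fun hbc z hz => Or.inl (hsign.root_mem_ball hbc hcd hf.ne_zero hz),
    fun hda z hz => Or.inl ?_⟩
  have hneg : f.comp (-Polynomial.X) ≠ 0 := fun h => hf.ne_zero (by
    have := congrArg (fun g : Polynomial ℝ => g.comp (-Polynomial.X)) h
    simpa [Polynomial.comp_assoc] using this)
  have h := hsign.comp_neg_X.root_mem_ball (neg_le_neg hda) (neg_le_neg hcd) hneg (z := -z) (by
    simpa [Polynomial.map_comp] using hz)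
  rw [Metric.mem_ball, dist_eq_norm] at h ⊢
  rw [← norm_neg]
  convert h using 1
  · push_cast
    congr 1
    ring
  · ring
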